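/- **Lemma (Local conservativity).** Let $d\in\{2,3\}$ and let $\Omega\subset\mathbb R^d$ be a bounded domain, equal to the interior of its closure, with polygonal boundary and with a simplicial triangulation $\tau_h$ without hanging nodes. Let $\mathcal T_H$ be a coarse partition of $\Omega$ such that every $T\in\mathcal T_H$ is covered by a nonempty set $\tau_h^T\subset\tau_h$ of fine elements; the sets $\tau_h^T$ partition $\tau_h$. For each fine face $e$ let $n_e$ be a unit normal, pointing from $t^-$ to $t^+$ if $e=\partial t^-\cap\partial t^+$ is an inner face, and outward from $t^-$ if $e\subset\partial t^-\cap\partial\Omega$ is a boundary face. Let $f\in L^2(\Omega)$ be bounded. For each parameter $\mu\in\mathcal P$ let $\lambda(\mu)$ be measurable, bounded above and bounded below by a positive constant (on each $t\in\tau_h$ including its traces on the faces of $t$). Let $\kappa_\varepsilon$ be constant, symmetric and positive definite on each $t\in\tau_h$. Put $\delta_e^\pm=n_e\cdot\kappa_\varepsilon|_{t^\pm}n_e$. On an inner face put $[\![q]\!]_e=q^--q^+$ and $\{\!\{q\}\!\}_e=\omega_e^-q^-+\omega_e^+q^+$, where $\omega_e^\pm>0$ and $\omega_e^-+\omega_e^+=1$;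 on a boundary face put $[\![q]\!]_e=\{\!\{q\}\!\}_e=q^-$. On inner faces between two different coarse elements, $\omega_e^\mp=\delta_e^\pm/(\delta_e^++\delta_e^-)$. Let $\sigma\ge1$, $h_e=\operatorname{diam}e$, $\sigma_\varepsilon^e=\delta_e^+\delta_e^- /(\delta_e^++\delta_e^-)$ on inner faces and $\sigma_\varepsilon^e=\delta_e^-$ on boundary faces, and $\sigma_e(\mu)=\sigma h_e^{-1}\{\!\{\lambda(\mu)\}\!\}_e\sigma_\varepsilon^e$. For functions that are polynomial on each $t\in\tau_h$ (with broken gradient $\nabla_h$) define $$b^t(p,q;\mu)=\int_t(\lambda(\mu)\kappa_\varepsilon\nabla p)\cdot\nabla q,\qquad b_c^e(p,q;\mu)=-\int_e\{\!\{(\lambda(\mu)\kappa_\varepsilon\nabla_hp)\cdot n_e\}\!\}_e[\![q]\!]_e,\qquad b_p^e(p,q;\mu)=\int_e\sigma_e(\mu)[\![p]\!]_e[\![q]\!]_e .$$ For each $T\in\mathcal T_H$ let $\vartheta_T\in\{-1,0,1\}$. Put $\vartheta_e=\vartheta_T$ on fine faces $e$ in the interior of $T$, and $\vartheta_e=1$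 on fine faces lying on a coarse face (boundary faces and inner faces between different coarse elements). With $l(q)=\int_\Omega fq$ let $$b_h(p,q;\mu)=\sum_{t\in\tau_h}b^t(p,q;\mu)+\sum_{e}\big(\vartheta_e\,b_c^e(q,p;\mu)+b_c^e(p,q;\mu)+b_p^e(q,p;\mu)\big),$$ the second sum running over all fine faces. Let $k\ge1$ and $k-1\le l\le k$. For each $T$ let $Q_h^{k,T}$ be either the space of all functions on $T$ whose restriction to each $t\in\tau_h^T$ is in $\mathbb P_k(t)$, or its subspace of functions that are continuous on $T$. Let $Q_h^k$ be the space of functions $q$ with $q|_T\in Q_h^{k,T}$ for all $T$. Let $Q_{\rm red}^T\subset Q_h^{k,T}$ be linear subspaces and $Q_{\rm red}(\mathcal T_H)=\{q\in Q_h^k: q|_T\in Q_{\rm red}^T\ \forall T\}$. Let $V_h^l(\tau_h)$ be the space of $v\in H_{\rm div}(\Omega)$ with $v|_t\in[\mathbb P_l(t)]^d+x\,\mathbb P_l(t)$ for all $t\in\tau_h$. For $p\in Q_h^k$, a diffusive flux reconstruction $u=R_h^l[p;\mu]$ is a $u\in V_h^l(\tau_h)$ such that, for every $t\in\tau_h$,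 $$\int_e(u\cdot n_e)\,q=-\int_e\{\!\{(\lambda(\mu)\kappa_\varepsilon\nabla_hp)\cdot n_e\}\!\}_e\,q+\int_e\sigma_e(\mu)[\![p]\!]_e\,q\qquad\text{for every face } e \text{ of } t \text{ and all } q\in\mathbb P_l(e),$$ $$\int_tu\cdot\nabla q=-b^t(p,q;\mu)-\sum_{e\subset\partial t}\vartheta_e\,b_c^e(q,p;\mu)\qquad\text{for all } q\in\mathbb P_l(t),$$ where in the last sum $q$ is extended by zero outside $t$. Suppose that the constant function $1$ lies in $Q_{\rm red}^T$ for every $T\in\mathcal T_H$. Let $\mu\in\mathcal P$, let $p_h(\mu)\in Q_h^k$ be the DG solution, that is, $b_h(p_h(\mu),q;\mu)=l(q)$ for all $q\in Q_h^k$, and let $p_{\rm red}(\mu)\in Q_{\rm red}(\mathcal T_H)$ be the reduced solution, that is, $b_h(p_{\rm red}(\mu),q;\mu)=l(q)$ for all $q\in Q_{\rm red}(\mathcal T_H)$. Then all diffusive flux reconstructions $u_h(\mu)=R_h^l[p_h(\mu);\mu]$ and $u_{\rm red}(\mu)=R_h^l[p_{\rm red}(\mu);\mu]$ satisfy $$\int_T\nabla\cdot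 u_h(\mu)=\int_Tf=\int_T\nabla\cdot u_{\rm red}(\mu)\qquad\text{for all }T\in\mathcal T_H .$$ -/

import Mathlib

open MeasureTheory
open scoped ContDiff Matrix

noncomputable section

namespace LRBMS

/-! ### Points, polynomials, simplices -/

/-- Points of `ℝ^d` with the Euclidean norm. -/
abbrev Pt (d : ℕ) := EuclideanSpace ℝ (Fin d)

/-- Real polynomials in `d` variables. -/
abbrev Poly (d : ℕ) := MvPolynomial (Fin d) ℝ

/-- The polynomials of total degree at most `k`. Since a nondegenerate simplex has interior points,
restriction identifies this space with `P_k(t)`; its restrictions to a face `e` form `P_k(e)`. -/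
abbrev PolyDeg (d k : ℕ) : Submodule ℝ (Poly d) := MvPolynomial.restrictTotalDegree (Fin d) ℝ k

variable {d : ℕ}

/-- Value of a polynomial at a point. -/
def evalAt (q : Poly d) (x : Pt d) : ℝ := MvPolynomial.eval (fun i => x i) q

/-- Gradient of a polynomial at a point. -/
def gradAt (q : Poly d) (x : Pt d) : Fin d → ℝ := fun i => evalAt (MvPolynomial.pderiv i q) x

/-- Value of a polynomial vector field at a point. -/
def vecAt (U : Fin d → Poly d) (x : Pt d) : Fin d → ℝ := fun i => evalAt (U i) x

/-- The closed simplex spanned by a finite set of vertices. -/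
def cell (s : Finset (Pt d)) : Set (Pt d) := convexHull ℝ (s : Set (Pt d))

/-- Surface integral over the `(d-1)`-dimensional simplex with vertex set `e`. -/
def faceIntegral (e : Finset (Pt d)) (g : Pt d → ℝ) : ℝ :=
  ∫ x in cell e, g x ∂(μHE[d - 1] : Measure (Pt d))

/-! ### The space `H_div(Ω)` -/

/-- `g ∈ L²(Ω)` is the weak divergence of `u ∈ L²(Ω)^d`. -/
structure HasWeakDiv (Ω : Set (Pt d)) (u : Pt d → Pt d) (g : Pt d → ℝ) : Prop where
  memLp_field : MemLp u 2 (volume.restrict Ω)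
  memLp_div : MemLp g 2 (volume.restrict Ω)
  weak : ∀ φ : Pt d → ℝ, ContDiff ℝ ∞ φ → HasCompactSupport φ → tsupport φ ⊆ Ω →
    ∫ x in Ω, inner ℝ (u x) (gradient φ x) = - ∫ x in Ω, g x * φ x

/-- Membership in `H_div(Ω)`. -/
def InHDiv (Ω : Set (Pt d)) (u : Pt d → Pt d) : Prop := ∃ g, HasWeakDiv Ω u g

/-! ### The domain, the fine triangulation, the coarse partition -/

/-- Bounded connected domains lying on one side of their boundary (no slits). That the boundary is
polygonal is expressed by the existence of a `Triangulation`. -/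
structure IsBoundedDomain (Ω : Set (Pt d)) : Prop where
  isOpen : IsOpen Ω
  isConnected : IsConnected Ω
  isBounded : Bornology.IsBounded Ω
  interior_closure : interior (closure Ω) = Ω

/-- A simplicial triangulation of `Ω` without hanging nodes; an element is represented by the set of
its `d + 1` vertices. -/
structure Triangulation (Ω : Set (Pt d)) where
  elems : Finset (Finset (Pt d))
  card_eq : ∀ t ∈ elems, t.card = d + 1
  indep : ∀ t ∈ elems, AffineIndependent ℝ ((↑) : t → Pt d)
  cover : ⋃ t ∈ elems, cell t = closure Ω
  conforming : ∀ s ∈ elems, ∀ t ∈ elems,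
    cell s ∩ cell t = convexHull ℝ ((s : Set (Pt d)) ∩ (t : Set (Pt d)))

/-- The faces of a simplex: the subsets of `d` of its `d + 1` vertices. -/
def facesOf (t : Finset (Pt d)) : Finset (Finset (Pt d)) := t.powersetCard d

namespace Triangulation

variable {Ω : Set (Pt d)}

open scoped Classical in
/-- All fine faces. -/
def faces (τ : Triangulation Ω) : Finset (Finset (Pt d)) := τ.elems.biUnion facesOf

/-- Inner faces are those shared by two elements; all other faces are boundary faces. -/
def IsInner (τ : Triangulation Ω) (e : Finset (Pt d)) : Prop :=
  e ∈ τ.faces ∧ ∃ s ∈ τ.elems, ∃ t ∈ τ.elems, s ≠ t ∧ e ⊆ s ∧ e ⊆ t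

end Triangulation

/-- The choice, for each face `e`, of `t⁻`, of `t⁺` (on inner faces) and of the unit normal `n_e`,
which points from `t⁻` to `t⁺` on an inner face and out of `Ω` (that is, out of `t⁻`) on a
boundary face. -/
structure Orientation {Ω : Set (Pt d)} (τ : Triangulation Ω) where
  neg : Finset (Pt d) → Finset (Pt d)
  pos : Finset (Pt d) → Finset (Pt d)
  normal : Finset (Pt d) → Pt d
  neg_spec : ∀ e ∈ τ.faces, neg e ∈ τ.elems ∧ e ⊆ neg e
  pos_spec : ∀ e, τ.IsInner e → pos e ∈ τ.elems ∧ e ⊆ pos e ∧ pos e ≠ neg e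
  /-- An inner face belongs to `t⁻` and `t⁺` only. -/
  adjacent : ∀ e, τ.IsInner e → ∀ t ∈ τ.elems, e ⊆ t → t = neg e ∨ t = pos e
  norm_normal : ∀ e ∈ τ.faces, ‖normal e‖ = 1
  normal_orth : ∀ e ∈ τ.faces, ∀ x ∈ e, ∀ y ∈ e, inner ℝ (normal e) (y - x) = 0
  normal_neg : ∀ e ∈ τ.faces, ∀ x ∈ e, ∀ a ∈ neg e, a ∉ e → inner ℝ (normal e) (a - x) < 0
  normal_pos : ∀ e, τ.IsInner e → ∀ x ∈ e, ∀ a ∈ pos e, a ∉ e → 0 < inner ℝ (normal e) (a - x)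

/-- The coarse partition, whose elements are labelled by `ι`: every fine element `t` lies in exactly
one coarse element `part t`, and every coarse element is covered by at least one fine element. -/
structure CoarsePartition {Ω : Set (Pt d)} (τ : Triangulation Ω) (ι : Type*) where
  part : Finset (Pt d) → ι
  nonempty : ∀ T : ι, ∃ t ∈ τ.elems, part t = T

namespace CoarsePartition

variable {Ω : Set (Pt d)} {τ : Triangulation Ω} {ι : Type*}

open scoped Classical in
/-- `τ_h^T`, the fine elements covering the coarse element `T`. -/
def cells (C : CoarsePartition τ ι) (T : ι) : Finset (Finset (Pt d)) :=
  τ.elems.filter fun t => C.part t = T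

/-- The coarse element `T` as a (closed) subset of `ℝ^d`. -/
def region (C : CoarsePartition τ ι) (T : ι) : Set (Pt d) := ⋃ t ∈ C.cells T, cell t

/-- A fine face lying in the interior of the coarse element `T`: an inner face both of whose
elements belong to `T`. -/
def IsInnerOf (C : CoarsePartition τ ι) (T : ι) (e : Finset (Pt d)) : Prop :=
  τ.IsInner e ∧ ∀ t ∈ τ.elems, e ⊆ t → C.part t = T

open scoped Classical in
/-- The fine faces in the interior of the coarse element `T`. -/
def innerFaces (C : CoarsePartition τ ι) (T : ι) : Finset (Finset (Pt d)) :=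
  τ.faces.filter fun e => C.IsInnerOf T e

open scoped Classical in
/-- The fine faces that lie on some coarse face: the boundary faces and the inner faces between
two different coarse elements. -/
def skeleton (C : CoarsePartition τ ι) : Finset (Finset (Pt d)) :=
  τ.faces.filter fun e => ∀ T, ¬ C.IsInnerOf T e

end CoarsePartition

/-- The coarse faces, labelled by `ι'`: every fine face of the skeleton lies on exactly one coarse
face `label e`, and all fine faces on one coarse face are adjacent to the same coarse elements. -/
structure CoarseFaces {Ω : Set (Pt d)} {τ : Triangulation Ω} {ι : Type*}
    (C : CoarsePartition τ ι) (ι' : Type*) where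
  label : Finset (Pt d) → ι'
  nonempty : ∀ F : ι', ∃ e ∈ C.skeleton, label e = F
  same_elements : ∀ e ∈ C.skeleton, ∀ e' ∈ C.skeleton, label e = label e' →
    ∀ T : ι, (∃ t ∈ C.cells T, e ⊆ t) ↔ (∃ t ∈ C.cells T, e' ⊆ t)

/-! ### The data of the problem and of the discretization -/

/-- The two local ansatz spaces: continuous (`S_h^k`) and discontinuous (`Q_h^k`) elements. -/
inductive LocalKind
  | cg
  | dg

/-- The problem together with its discretization.

* `lam μ t` is the function `λ(μ)` on the closed fine element `t`; its values on a face of `t` are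
  the one-sided trace of `λ(μ)` from `t`.
* `kap t` is the constant value of `κ_ε` on the fine element `t`.
* `sigma` is the penalty parameter `σ`.
* `theta T` and `omega e` are the parameter `ϑ` of the local discretization on the coarse element
  `T` and the weight `ω_e⁻` on a face `e` in the interior of a coarse element (there
  `ω_e⁺ = 1 - ω_e⁻`). -/
structure Scheme (Ω : Set (Pt d)) (ι ι' P : Type*) where
  τ : Triangulation Ω
  O : Orientation τ
  C : CoarsePartition τ ι
  F : CoarseFaces C ι'
  f : Pt d → ℝ
  f_memLp : MemLp f 2 (volume.restrict Ω)
  f_bounded : ∃ M : ℝ, ∀ᵐ x ∂(volume.restrict Ω), |f x| ≤ M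
  lam : P → Finset (Pt d) → Pt d → ℝ
  lam_measurable : ∀ μ, ∀ t ∈ τ.elems, Measurable (lam μ t)
  lam_bounds : ∀ μ, ∃ c C' : ℝ, 0 < c ∧ ∀ t ∈ τ.elems, ∀ x ∈ cell t, c ≤ lam μ t x ∧ lam μ t x ≤ C'
  kap : Finset (Pt d) → Matrix (Fin d) (Fin d) ℝ
  kap_posDef : ∀ t ∈ τ.elems, (kap t).PosDef
  sigma : ℝ
  one_le_sigma : 1 ≤ sigma
  theta : ι → ℝ
  theta_mem : ∀ T, theta T = -1 ∨ theta T = 0 ∨ theta T = 1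
  omega : Finset (Pt d) → ℝ
  omega_mem : ∀ T, ∀ e ∈ C.innerFaces T, 0 < omega e ∧ omega e < 1
  kind : ι → LocalKind

/-- A broken polynomial: a polynomial `q t` on each fine element `t` (the values of `q` outside the
set of fine elements are never used). -/
abbrev Broken (d : ℕ) := Finset (Pt d) → Poly d

namespace Scheme

variable {Ω : Set (Pt d)} {ι ι' P : Type*} (S : Scheme Ω ι ι' P)

/-! ### Jumps, weights, penalty -/

/-- `n_e · κ⁻ n_e`. -/
def deltaNeg (e : Finset (Pt d)) : ℝ :=
  (fun i => S.O.normal e i) ⬝ᵥ (S.kap (S.O.neg e) *ᵥ fun i => S.O.normal e i)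

/-- `n_e · κ⁺ n_e` (used on inner faces only). -/
def deltaPos (e : Finset (Pt d)) : ℝ :=
  (fun i => S.O.normal e i) ⬝ᵥ (S.kap (S.O.pos e) *ᵥ fun i => S.O.normal e i)

open scoped Classical in
/-- `ω_e⁻`: the weight of the local discretization in the interior of coarse elements, the SWIPDG
weight on inner faces that lie on coarse faces, and `1` on boundary faces. -/
def wNeg (e : Finset (Pt d)) : ℝ :=
  if S.τ.IsInner e then
    if e ∈ S.C.skeleton then S.deltaPos e / (S.deltaPos e + S.deltaNeg e) else S.omega e
  else 1

open scoped Classical in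
/-- `ω_e⁺`; it is `0` on boundary faces. -/
def wPos (e : Finset (Pt d)) : ℝ :=
  if S.τ.IsInner e then
    if e ∈ S.C.skeleton then S.deltaNeg e / (S.deltaPos e + S.deltaNeg e) else 1 - S.omega e
  else 0

open scoped Classical in
/-- The jump `⟦q⟧_e`. -/
def jump (q : Broken d) (e : Finset (Pt d)) (x : Pt d) : ℝ :=
  if S.τ.IsInner e then evalAt (q (S.O.neg e)) x - evalAt (q (S.O.pos e)) x
  else evalAt (q (S.O.neg e)) x

/-- The weighted average `⦃λ(μ)⦄_e`. -/
def lamAvg (μ : P) (e : Finset (Pt d)) (x : Pt d) : ℝ :=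
  S.wNeg e * S.lam μ (S.O.neg e) x + S.wPos e * S.lam μ (S.O.pos e) x

/-- `λ(μ) κ_ε ∇p` on the fine element `t`. -/
def flux (μ : P) (t : Finset (Pt d)) (p : Poly d) (x : Pt d) : Fin d → ℝ :=
  S.lam μ t x • (S.kap t *ᵥ gradAt p x)

/-- The weighted average `⦃(λ(μ) κ_ε ∇_h p) · n_e⦄_e`. -/
def fluxAvg (μ : P) (p : Broken d) (e : Finset (Pt d)) (x : Pt d) : ℝ :=
  S.wNeg e * (S.flux μ (S.O.neg e) (p (S.O.neg e)) x ⬝ᵥ fun i => S.O.normal e i) +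
    S.wPos e * (S.flux μ (S.O.pos e) (p (S.O.pos e)) x ⬝ᵥ fun i => S.O.normal e i)

open scoped Classical in
/-- The locally adaptive weight `σ_ε^e`. -/
def sigmaEps (e : Finset (Pt d)) : ℝ :=
  if S.τ.IsInner e then S.deltaPos e * S.deltaNeg e / (S.deltaPos e + S.deltaNeg e)
  else S.deltaNeg e

/-- The penalty function `σ_e(μ) = σ h_e⁻¹ ⦃λ(μ)⦄_e σ_ε^e`. -/
def penalty (μ : P) (e : Finset (Pt d)) (x : Pt d) : ℝ :=
  S.sigma * (Metric.diam (cell e))⁻¹ * S.lamAvg μ e x * S.sigmaEps e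

/-! ### The bilinear forms -/

/-- The coupling term `∫_e -⦃(λ κ ∇_h p) · n_e⦄ j`, with `j` in the place of the jump of the second
argument. -/
def coupling (μ : P) (e : Finset (Pt d)) (p : Broken d) (j : Pt d → ℝ) : ℝ :=
  faceIntegral e fun x => - S.fluxAvg μ p e x * j x

/-- The penalty term `∫_e σ_e(μ) ⟦p⟧ j`, with `j` in the place of the jump of the second argument. -/
def penalization (μ : P) (e : Finset (Pt d)) (p : Broken d) (j : Pt d → ℝ) : ℝ :=
  faceIntegral e fun x => S.penalty μ e x * S.jump p e x * j x

/-- `b_c^e(p, q; μ)`. -/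
def bc (μ : P) (e : Finset (Pt d)) (p q : Broken d) : ℝ := S.coupling μ e p (S.jump q e)

/-- `b_p^e(p, q; μ)`. -/
def bp (μ : P) (e : Finset (Pt d)) (p q : Broken d) : ℝ := S.penalization μ e p (S.jump q e)

/-- `b^t(p, q; μ)` on a fine element `t`. -/
def bCell (μ : P) (t : Finset (Pt d)) (p q : Poly d) : ℝ :=
  ∫ x in cell t, S.flux μ t p x ⬝ᵥ gradAt q x

/-- `b^T(p, q; μ)` on a coarse element `T`. -/
def bLocal (μ : P) (T : ι) (p q : Broken d) : ℝ := ∑ t ∈ S.C.cells T, S.bCell μ t (p t) (q t)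

/-- `b_h^T(p, q; μ)`. -/
def bhLocal (μ : P) (T : ι) (p q : Broken d) : ℝ :=
  S.bLocal μ T p q +
    ∑ e ∈ S.C.innerFaces T, (S.theta T * S.bc μ e q p + S.bc μ e p q + S.bp μ e q p)

open scoped Classical in
/-- `b_h^E(p, q; μ)` on a coarse face `E`. -/
def bhFace (μ : P) (E : ι') (p q : Broken d) : ℝ :=
  ∑ e ∈ S.C.skeleton.filter (fun e => S.F.label e = E),
    (S.bc μ e q p + S.bc μ e p q + S.bp μ e q p)

/-- `b_h(p, q; μ)`. -/
def bh [Fintype ι] [Fintype ι'] (μ : P) (p q : Broken d) : ℝ :=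
  ∑ T : ι, S.bhLocal μ T p q + ∑ E : ι', S.bhFace μ E p q

/-- `l^T(q)`. -/
def rhsLocal (T : ι) (q : Broken d) : ℝ := ∑ t ∈ S.C.cells T, ∫ x in cell t, S.f x * evalAt (q t) x

/-- `l(q)`. -/
def rhs [Fintype ι] (q : Broken d) : ℝ := ∑ T : ι, S.rhsLocal T q

/-! ### Discrete and reduced spaces and solutions -/

/-- The local ansatz space `Q_h^{k,T}`: the polynomials of degree at most `k` on each fine element
of `T`, in the continuous case subject to continuity on `T`. -/
def localSpace (k : ℕ) (T : ι) : Submodule ℝ (S.C.cells T → Poly d) where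
  carrier := {q | (∀ t, q t ∈ PolyDeg d k) ∧ (S.kind T = LocalKind.cg →
    ∀ s t : S.C.cells T, ∀ x ∈ cell s.1 ∩ cell t.1, evalAt (q s) x = evalAt (q t) x)}
  zero_mem' := ⟨fun _ => Submodule.zero_mem _, fun _ _ _ _ _ => rfl⟩
  add_mem' := by
    rintro p q ⟨hp, hp'⟩ ⟨hq, hq'⟩
    refine ⟨fun t => Submodule.add_mem _ (hp t) (hq t), fun h s t x hx => ?_⟩
    have h1 := hp' h s t x hx
    have h2 := hq' h s t x hx
    simp only [evalAt, Pi.add_apply, map_add] at *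
    rw [h1, h2]
  smul_mem' := by
    rintro c q ⟨hq, hq'⟩
    refine ⟨fun t => Submodule.smul_mem _ c (hq t), fun h s t x hx => ?_⟩
    have h2 := hq' h s t x hx
    simp only [evalAt, Pi.smul_apply, MvPolynomial.smul_eval] at *
    rw [h2]

/-- The restriction `q|_T`. -/
def restr (T : ι) (q : Broken d) : S.C.cells T → Poly d := fun t => q t.1

/-- `q ∈ Q_h^k`. -/
def InDG (k : ℕ) (q : Broken d) : Prop := ∀ T : ι, S.restr T q ∈ S.localSpace k T

/-- `q ∈ Q_red(𝒯_H)` for the local reduced spaces `Q T` of polynomial order `k`. -/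
def InReduced (k : ℕ) (Q : ∀ T : ι, Submodule ℝ (S.C.cells T → Poly d)) (q : Broken d) : Prop :=
  S.InDG k q ∧ ∀ T : ι, S.restr T q ∈ Q T

/-- `p` is the DG solution for the parameter `μ`. -/
def IsDGSolution [Fintype ι] [Fintype ι'] (k : ℕ) (μ : P) (p : Broken d) : Prop :=
  S.InDG k p ∧ ∀ q, S.InDG k q → S.bh μ p q = S.rhs q

/-- `p` is the reduced solution for the parameter `μ`. -/
def IsReducedSolution [Fintype ι] [Fintype ι'] (k : ℕ)
    (Q : ∀ T : ι, Submodule ℝ (S.C.cells T → Poly d)) (μ : P) (p : Broken d) : Prop :=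
  S.InReduced k Q p ∧ ∀ q, S.InReduced k Q q → S.bh μ p q = S.rhs q

/-! ### Diffusive flux reconstruction -/

/-- `u ∈ V_h^l(τ_h)`, where `U t` is the polynomial field `u|_t ∈ [P_l(t)]^d + x P_l(t)`. -/
structure IsRTN (l : ℕ) (u : Pt d → Pt d) (U : Finset (Pt d) → Fin d → Poly d) : Prop where
  inHDiv : InHDiv Ω u
  ae_eq : ∀ t ∈ S.τ.elems, ∀ᵐ x ∂(volume.restrict (cell t)), ∀ i, u x i = vecAt (U t) x i
  local_form : ∀ t ∈ S.τ.elems, ∃ a : Fin d → Poly d, ∃ b : Poly d,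
    (∀ i, a i ∈ PolyDeg d l) ∧ b ∈ PolyDeg d l ∧ ∀ i, U t i = a i + MvPolynomial.X i * b

open scoped Classical in
/-- `ϑ` on a fine face: `1` on coarse faces, else that of the local discretization. -/
def thetaFace (e : Finset (Pt d)) : ℝ :=
  if e ∈ S.C.skeleton then 1 else S.theta (S.C.part (S.O.neg e))

open scoped Classical in
/-- The polynomial `q` on the fine element `t`, extended by zero to the other elements. -/
def extendZero (t : Finset (Pt d)) (q : Poly d) : Broken d := fun s => if s = t then q else 0

/-- `u = R_h^l[p; μ]`: `u ∈ V_h^l(τ_h)` satisfies the two families of conditions that specify the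
diffusive flux reconstruction of `p`. A face polynomial `q ∈ P_l(e)` takes the place of the jump in
`b_c^e(p, q; μ)` and `b_p^e(p, q; μ)`; the normal trace on a face of `t` is taken from `t`. -/
def IsFluxReconstruction (l : ℕ) (μ : P) (p : Broken d) (u : Pt d → Pt d) : Prop :=
  ∃ U : Finset (Pt d) → Fin d → Poly d, S.IsRTN l u U ∧
    (∀ t ∈ S.τ.elems, ∀ e ∈ facesOf t, ∀ q ∈ PolyDeg d l,
      faceIntegral e (fun x => (vecAt (U t) x ⬝ᵥ fun i => S.O.normal e i) * evalAt q x) =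
        S.coupling μ e p (evalAt q) + S.penalization μ e p (evalAt q)) ∧
    (∀ t ∈ S.τ.elems, ∀ q ∈ PolyDeg d l,
      ∫ x in cell t, vecAt (U t) x ⬝ᵥ gradAt q x =
        - S.bCell μ t (p t) q -
          ∑ e ∈ facesOf t, S.thetaFace e * S.bc μ e (extendZero t q) p)

/-- The local conservation property `(∇ · u, 1)_T = (f, 1)_T` on every coarse element `T`. -/
def LocallyConservative (u : Pt d → Pt d) : Prop :=
  InHDiv Ω u ∧ ∀ g, HasWeakDiv Ω u g →
    ∀ T : ι, ∫ x in S.C.region T, g x = ∫ x in S.C.region T, S.f x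

end Scheme

end LRBMS

end

/-!
Local conservativity is obtained by testing the discrete equation with the characteristic function
`1_T` of a coarse element `T`, which is an admissible test function because the constant `1` lies in
every local space. Its broken gradient vanishes, so `b^t` and the symmetrizing terms `b_c^e(1_T, p)`
drop out, and its jump vanishes on the faces in the interior of every coarse element. What remains
of `b_h(p, 1_T) = l(1_T)` is (`Scheme.bh_coarseIndicator`, `Scheme.rhs_coarseIndicator`)

  `∑_{e on coarse faces} ⟦1_T⟧_e X_e = ∫_T f`,

where `X_e = ∫_e (-⦃(λ κ ∇_h p) · n_e⦄ + σ_e ⟦p⟧)` is the numerical flux through `e`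
(`Scheme.faceFlux`). The face conditions of the reconstruction, tested with the constant `1`, say
that `∫_e u · n_e = X_e`, whether the trace is taken from `t⁻` or from `t⁺`.

On the other hand, a weak divergence `g` of `u` agrees on every fine element `t` with the classical
divergence of the polynomial field `u|_t` (`HasWeakDiv.setIntegral_cell`), and the divergence
theorem turns `∫_t g` into the sum of the outward fluxes `± X_e` over the faces of `t`
(`setIntegral_divAt_elem`). Summed over the fine elements of `T`, the contributions of the faces in
the interior of `T` cancel, and a face on a coarse face keeps the factor `⟦1_T⟧_e`
(`Scheme.sum_sign_faceFlux`). Hence `∫_T g = ∫_T f`.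

The analytic ingredient is the divergence theorem on a simplex with the surface measure given by the
Euclidean Hausdorff measure (`IsOuterNormals.setIntegral_fderiv`). Both sides are linear in the
direction of differentiation, and the edges span the space, so it suffices to differentiate along an
edge from `b j` to `b i`. Every normal other than those of the faces opposite `b i` and `b j` is
orthogonal to this edge. With a unit vector `u` along the edge, the simplex is the region between
these two faces, which are graphs over a common subset of the hyperplane orthogonal to `u`. Fubini's
theorem and the fundamental theorem of calculus express the integral by integrals over that subset,
and the Jacobian of a graph with unit normal `n` is `1 / |⟪n, u⟫|` (`normDet_graph`).
-/

noncomputable section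

open MeasureTheory Measure Module

namespace LRBMS

/-! ### Graphs over a hyperplane and integration along lines -/

section Graph

variable {V : Type*} [NormedAddCommGroup V] [InnerProductSpace ℝ V] [FiniteDimensional ℝ V]

/-- The volume factor of the linear graph `z ↦ z + h z • u` over the hyperplane orthogonal to a unit
vector `u`, when the graph has the unit normal `n`. In an orthonormal basis `b i` of the hyperplane
the Gram matrix of the map is the identity plus the rank-one matrix with entries
`h (b i) * h (b j)`, whose determinant is `1 + ‖h‖² = ⟪n, u⟫⁻²`. -/
theorem normDet_graph {u n : V} (hu : ‖u‖ = 1) (hn : ‖n‖ = 1) (hnu : inner ℝ n u ≠ 0)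
    (h : (ℝ ∙ u)ᗮ →ₗ[ℝ] ℝ) (hh : ∀ z : (ℝ ∙ u)ᗮ, inner ℝ n ((z : V) + h z • u) = 0) :
    ((ℝ ∙ u)ᗮ.subtype + h.smulRight u).normDet = |inner ℝ n u|⁻¹ := by
  set b := stdOrthonormalBasis ℝ (ℝ ∙ u)ᗮ
  have hhz : ∀ z : (ℝ ∙ u)ᗮ, h z = - inner ℝ n (z : V) / inner ℝ n u := by
    intro z
    have := hh z
    rw [inner_add_right, inner_smul_right] at this
    field_simp
    linarith
  have hz : ∀ z : (ℝ ∙ u)ᗮ, inner ℝ u (z : V) = 0 := fun z =>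
    Submodule.mem_orthogonal_singleton_iff_inner_right.1 z.2
  have hG : Matrix.gram ℝ (fun i => ((ℝ ∙ u)ᗮ.subtype + h.smulRight u) (b i)) =
      1 + Matrix.replicateCol Unit (fun i => h (b i)) *
        Matrix.replicateRow Unit (fun i => h (b i)) := by
    ext i j
    have hij := orthonormal_iff_ite.1 b.orthonormal i j
    rw [Submodule.coe_inner] at hij
    simp only [Matrix.gram_apply, LinearMap.add_apply, Submodule.subtype_apply,
      LinearMap.smulRight_apply, inner_add_left, inner_add_right, inner_smul_left,
      inner_smul_right, hz, hij, real_inner_self_eq_norm_sq, hu, Matrix.add_apply,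
      Matrix.one_apply, Matrix.mul_apply, Matrix.replicateCol_apply, Matrix.replicateRow_apply,
      real_inner_comm]
    simp [mul_comm]
  have hsq := LinearMap.normDet_sq_eq_det_gram ((ℝ ∙ u)ᗮ.subtype + h.smulRight u) b
  rw [hG, Matrix.det_one_add_replicateCol_mul_replicateRow] at hsq
  -- the projection of `n` to the orthogonal complement of `u` has squared norm `1 - ⟪n, u⟫²`
  have hpars : ∑ i, (inner ℝ n (b i : V)) ^ 2 = 1 - (inner ℝ n u) ^ 2 := by
    set w : (ℝ ∙ u)ᗮ := ⟨n - inner ℝ u n • u, by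
      rw [Submodule.mem_orthogonal_singleton_iff_inner_right]
      simp [inner_sub_right, inner_smul_right, hu]⟩
    have hw : ∀ i, inner ℝ n (b i : V) = inner ℝ w (b i) := by
      intro i
      rw [Submodule.coe_inner]
      simp [w, inner_sub_left, inner_smul_left, hz]
    have h1 := b.sum_sq_norm_inner_left w
    have h2 : ‖w‖ ^ 2 = 1 - (inner ℝ n u) ^ 2 := by
      rw [← real_inner_self_eq_norm_sq, Submodule.coe_inner]
      simp only [w, inner_sub_left, inner_sub_right, inner_smul_left, inner_smul_right,
        real_inner_self_eq_norm_sq, hu, hn, real_inner_comm n u]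
      simp; ring
    rw [← h2, ← h1]
    refine Finset.sum_congr rfl fun i _ => ?_
    rw [hw]; simp
  have hval : (((ℝ ∙ u)ᗮ.subtype + h.smulRight u).normDet) ^ 2 = (|inner ℝ n u|⁻¹) ^ 2 := by
    have : (fun i => h (b i)) ⬝ᵥ (fun i => h (b i)) = (∑ i, (inner ℝ n (b i : V)) ^ 2) /
        (inner ℝ n u) ^ 2 := by
      rw [dotProduct, Finset.sum_div]
      refine Finset.sum_congr rfl fun i _ => ?_
      rw [hhz]; field_simp
    rw [this, hpars] at hsq
    simp only [RCLike.ofReal_real_eq_id, id] at hsq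
    rw [hsq, inv_pow, sq_abs]
    field_simp
    ring
  exact (sq_eq_sq₀ (LinearMap.normDet_nonneg _) (by positivity)).1 hval

/-- The parametrization `z ↦ z + (c + h z) • u` of an affine graph over the hyperplane orthogonal to
`u`. -/
def graphMap (u : V) (c : ℝ) (h : (ℝ ∙ u)ᗮ →ₗ[ℝ] ℝ) (z : (ℝ ∙ u)ᗮ) : V := (z : V) + (c + h z) • u

theorem isClosedEmbedding_graphMap (u : V) (c : ℝ) (h : (ℝ ∙ u)ᗮ →ₗ[ℝ] ℝ) :
    Topology.IsClosedEmbedding (graphMap u c h) := by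
  have hinj : Function.Injective ((ℝ ∙ u)ᗮ.subtype + h.smulRight u) := by
    rw [← LinearMap.ker_eq_bot, LinearMap.ker_eq_bot']
    intro z hz
    simp only [LinearMap.add_apply, Submodule.subtype_apply, LinearMap.smulRight_apply] at hz
    have h1 : (z : V) ∈ (ℝ ∙ u) := by
      rw [eq_neg_of_add_eq_zero_left hz]
      exact Submodule.neg_mem _ (Submodule.smul_mem _ _ (Submodule.mem_span_singleton_self u))
    have := Submodule.inner_right_of_mem_orthogonal h1 z.2
    rw [inner_self_eq_zero] at this
    exact_mod_cast this
  have h1 := LinearMap.isClosedEmbedding_of_injective (LinearMap.ker_eq_bot.2 hinj)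
  have h2 := (Homeomorph.addLeft (c • u)).isClosedEmbedding.comp h1
  convert h2 using 1
  ext z
  simp [graphMap, add_smul]
  abel

variable [MeasurableSpace V] [BorelSpace V]

/-- Lebesgue measure splits as a product along the line spanned by a unit vector and the orthogonal
hyperplane. -/
theorem measurePreserving_smul_add_orthogonal {u : V} (hu : ‖u‖ = 1) :
    MeasurePreserving (fun p : ℝ × (ℝ ∙ u)ᗮ => p.1 • u + (p.2 : V))
      (volume.prod volume) volume := by
  have h1 := ((ℝ ∙ u).measurePreserving_measurableEquivProd (0 : V)).symm
  rw [InnerProductSpace.euclideanHausdorffMeasure_eq_volume] at h1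
  have h2 := (LinearIsometryEquiv.toSpanUnitSingleton (𝕜 := ℝ) u hu).measurePreserving.prod
    (MeasurePreserving.id (volume : Measure (ℝ ∙ u)ᗮ))
  have h3 := h1.comp h2
  convert! h3 using 1
  ext p
  simp

theorem measurableEmbedding_smul_add_orthogonal {u : V} (hu : ‖u‖ = 1) :
    MeasurableEmbedding (fun p : ℝ × (ℝ ∙ u)ᗮ => p.1 • u + (p.2 : V)) := by
  have h1 := ((ℝ ∙ u).measurableEquivProd (0 : V)).symm.measurableEmbedding
  have h2 := ((LinearIsometryEquiv.toSpanUnitSingleton (𝕜 := ℝ) u hu).toHomeomorph.prodCongr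
    (Homeomorph.refl (ℝ ∙ u)ᗮ)).measurableEmbedding
  have h3 := h1.comp h2
  convert! h3 using 1
  ext p
  simp

/-- Integrals over a compact part of an affine graph with respect to surface measure, computed in
the parametrization over the hyperplane. -/
theorem setIntegral_graphMap {u n : V} {m : ℕ} (hm : finrank ℝ V = m + 1) (hu : ‖u‖ = 1)
    (hn : ‖n‖ = 1) (hnu : inner ℝ n u ≠ 0) (c : ℝ)
    (h : (ℝ ∙ u)ᗮ →ₗ[ℝ] ℝ) (hh : ∀ z : (ℝ ∙ u)ᗮ, inner ℝ n ((z : V) + h z • u) = 0)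
    {A : Set V} (hA : A ⊆ Set.range (graphMap u c h)) (hAc : IsCompact A) {F : V → ℝ}
    (hF : Continuous F) :
    ∫ z in graphMap u c h ⁻¹' A, F (graphMap u c h z) =
      |inner ℝ n u| * ∫ x in A, F x ∂μHE[m] ∧ IntegrableOn F A μHE[m] := by
  have hu0 : u ≠ 0 := by rintro rfl; simp at hu
  have hfr : finrank ℝ (ℝ ∙ u)ᗮ = m := by
    have := (ℝ ∙ u).finrank_add_finrank_orthogonal
    rw [finrank_span_singleton hu0] at this; omega
  have hemb := isClosedEmbedding_graphMap u c h
  have hme := hemb.measurableEmbedding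
  -- pulled back along the graph, surface measure is a multiple of Lebesgue measure
  have hcomap : (μHE[m] : Measure V).comap (graphMap u c h) =
      ENNReal.ofReal |inner ℝ n u|⁻¹ • volume := by
    ext s hs
    rw [hme.comap_apply, Measure.smul_apply, smul_eq_mul, ← normDet_graph hu hn hnu h hh,
      ← LinearMap.euclideanHausdorffMeasure_image_eq_normDet_mul_volume, hfr,
      ← (IsometryEquiv.addLeft (-(c • u))).isometry.euclideanHausdorffMeasure_image,
      Set.image_image]
    congr 1
    refine Set.image_congr fun z _ => ?_
    simp [graphMap, add_smul]
    abel
  have hmap : (μHE[m] : Measure V).restrict A = Measure.map (graphMap u c h)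
      (ENNReal.ofReal |inner ℝ n u|⁻¹ • volume.restrict (graphMap u c h ⁻¹' A)) := by
    rw [← Measure.restrict_smul, ← hcomap, ← hme.restrict_map, hme.map_comap,
      Measure.restrict_restrict hAc.measurableSet, Set.inter_eq_left.2 hA]
  constructor
  · rw [hmap, hme.integral_map, integral_smul_measure, ENNReal.toReal_ofReal (by positivity),
      smul_eq_mul, ← mul_assoc, mul_inv_cancel₀ (by positivity), one_mul]
  · rw [IntegrableOn, hmap, hme.integrable_map_iff]
    refine Integrable.smul_measure ?_ (by simp)
    exact ((hF.comp hemb.continuous).continuousOn).integrableOn_compact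
      (hemb.isCompact_preimage hAc)

/-- The integral of a derivative in the direction `u` over a compact set whose sections along `u`
are the intervals `[α z, β z]`, `z ∈ E`: the fundamental theorem of calculus on each section. -/
theorem setIntegral_lineDeriv_eq {u : V} (hu : ‖u‖ = 1) {K : Set V} (hK : IsCompact K)
    {E : Set (ℝ ∙ u)ᗮ} (hE : MeasurableSet E) {α β : (ℝ ∙ u)ᗮ → ℝ}
    (hαβ : ∀ z ∈ E, α z ≤ β z)
    (hKE : ∀ (s : ℝ) (z : (ℝ ∙ u)ᗮ), s • u + (z : V) ∈ K ↔ z ∈ E ∧ s ∈ Set.Icc (α z) (β z))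
    {F F' : V → ℝ} (hF' : Continuous F')
    (hd : ∀ (z : V) (s : ℝ), HasDerivAt (fun s : ℝ => F (z + s • u)) (F' (z + s • u)) s) :
    ∫ x in K, F' x = ∫ z in E, (F ((z : V) + β z • u) - F ((z : V) + α z • u)) := by
  have hmp := measurePreserving_smul_add_orthogonal hu
  have hme := measurableEmbedding_smul_add_orthogonal hu
  have hint : Integrable (K.indicator F') := by
    rw [integrable_indicator_iff hK.measurableSet]
    exact hF'.continuousOn.integrableOn_compact hK
  have hint' := (hmp.integrable_comp_emb hme).2 hint
  rw [← integral_indicator hK.measurableSet, ← hmp.integral_comp hme,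
    ← integral_indicator hE]
  refine (integral_prod_symm _ hint').trans ?_
  congr 1
  ext z
  by_cases hz : z ∈ E
  · rw [Set.indicator_of_mem hz]
    have : (fun s : ℝ => K.indicator F' (s • u + (z : V))) =
        (Set.Icc (α z) (β z)).indicator (fun s => F' ((z : V) + s • u)) := by
      ext s
      by_cases hs : s ∈ Set.Icc (α z) (β z)
      · rw [Set.indicator_of_mem hs, Set.indicator_of_mem ((hKE s z).2 ⟨hz, hs⟩), add_comm]
      · rw [Set.indicator_of_notMem hs, Set.indicator_of_notMem (fun h => hs ((hKE s z).1 h).2)]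
    refine (congrArg (fun f : ℝ → ℝ => ∫ s, f s) this).trans ?_
    rw [integral_indicator measurableSet_Icc, integral_Icc_eq_integral_Ioc,
      ← intervalIntegral.integral_of_le (hαβ z hz)]
    exact intervalIntegral.integral_eq_sub_of_hasDerivAt (fun s _ => hd z s)
      ((by fun_prop : Continuous fun s : ℝ => F' ((z : V) + s • u)).intervalIntegrable _ _)
  · rw [Set.indicator_of_notMem hz]
    have : (fun s : ℝ => K.indicator F' (s • u + (z : V))) = fun _ => 0 := by
      ext s
      rw [Set.indicator_of_notMem (fun h => hz ((hKE s z).1 h).1)]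
    refine (congrArg (fun f : ℝ → ℝ => ∫ s, f s) this).trans ?_
    exact integral_zero _ _

end Graph

/-! ### The divergence theorem on a simplex -/

section SimplexGeometry

variable {ι V : Type*} [Fintype ι] [NormedAddCommGroup V] [InnerProductSpace ℝ V]

/-- The face opposite the vertex `b i` in barycentric coordinates. -/
theorem _root_.AffineBasis.convexHull_image_compl_singleton (b : AffineBasis ι ℝ V) (i : ι) :
    convexHull ℝ (b '' {i}ᶜ) = {x | b.coord i x = 0 ∧ ∀ j, 0 ≤ b.coord j x} := by
  classical
  apply Set.Subset.antisymm
  · refine fun x hx => ⟨?_, ?_⟩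
    · have hc : Convex ℝ {x | b.coord i x = 0} := (convex_singleton (0 : ℝ)).affine_preimage _
      refine convexHull_min ?_ hc hx
      rintro _ ⟨j, hj, rfl⟩
      exact b.coord_apply_ne (Ne.symm hj)
    · have := convexHull_mono (𝕜 := ℝ) (Set.image_subset_range b {i}ᶜ) hx
      rw [b.convexHull_eq_nonneg_coord] at this
      exact this
  · rintro x ⟨hi, hx⟩
    have h1 := b.linear_combination_coord_eq_self x
    have h2 := b.sum_coord_apply_eq_one x
    rw [← Finset.add_sum_erase _ _ (Finset.mem_univ i), hi] at h1 h2
    rw [zero_smul, zero_add] at h1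
    rw [zero_add] at h2
    rw [← h1]
    exact (convex_convexHull ℝ _).sum_mem (fun j _ => hx j) h2 fun j hj =>
      subset_convexHull ℝ _ ⟨j, Finset.ne_of_mem_erase hj, rfl⟩

/-- `n i` is the outer unit normal of the simplex with vertices `b` on the face opposite the vertex
`b i`. -/
structure IsOuterNormals (b : AffineBasis ι ℝ V) (n : ι → V) : Prop where
  norm_eq_one : ∀ i, ‖n i‖ = 1
  orthogonal : ∀ i j k, j ≠ i → k ≠ i → inner ℝ (n i) (b j - b k) = 0
  outward : ∀ i k, k ≠ i → inner ℝ (n i) (b i - b k) < 0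

/-- The outer normal opposite `b i` is a negative multiple of the gradient of the `i`-th barycentric
coordinate. -/
theorem IsOuterNormals.exists_inner_eq [Nontrivial ι] {b : AffineBasis ι ℝ V} {n : ι → V}
    (hn : IsOuterNormals b n) (i : ι) :
    ∃ κ : ℝ, κ < 0 ∧ ∀ w, inner ℝ (n i) w = κ * (b.coord i).linear w := by
  classical
  obtain ⟨k, hk⟩ := exists_ne i
  refine ⟨inner ℝ (n i) (b i - b k), hn.outward i k hk, fun w => ?_⟩
  have key : ∀ x, inner ℝ (n i) (x - b k) = inner ℝ (n i) (b i - b k) * b.coord i x := by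
    intro x
    have h1 : x - b k = ∑ j, b.coord j x • (b j - b k) := by
      simp_rw [smul_sub]
      rw [Finset.sum_sub_distrib, b.linear_combination_coord_eq_self, ← Finset.sum_smul,
        b.sum_coord_apply_eq_one, one_smul]
    conv_lhs => rw [h1, inner_sum]
    rw [Finset.sum_eq_single i]
    · rw [inner_smul_right, mul_comm]
    · intro j _ hj
      rw [inner_smul_right, hn.orthogonal i j k hj hk, mul_zero]
    · simp
  have h1 := key (w +ᵥ b k)
  rw [AffineMap.map_vadd, b.coord_apply_ne hk.symm] at h1
  simpa using h1

end SimplexGeometry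

section Divergence

variable {ι V : Type*} [Fintype ι] [Nontrivial ι] [NormedAddCommGroup V] [InnerProductSpace ℝ V]
  [FiniteDimensional ℝ V] [MeasurableSpace V] [BorelSpace V]

/-- The divergence theorem on a simplex for the derivative along the edge from `b j` to `b i`. Only
the faces opposite `b i` and `b j` contribute, since the other normals are orthogonal to the edge.
The second part records that continuously differentiable functions are integrable on faces. -/
theorem IsOuterNormals.setIntegral_edge {m : ℕ} (hm : finrank ℝ V = m + 1)
    {b : AffineBasis ι ℝ V} {n : ι → V} (hn : IsOuterNormals b n) {i j : ι} (hij : i ≠ j)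
    {F : V → ℝ} {G : V → V →L[ℝ] ℝ} (hG : Continuous G) (hF : ∀ x, HasFDerivAt F (G x) x) :
    (∫ x in convexHull ℝ (Set.range b), G x (b i - b j) =
      inner ℝ (n i) (b i - b j) * ∫ x in convexHull ℝ (b '' {i}ᶜ), F x ∂μHE[m] +
      inner ℝ (n j) (b i - b j) * ∫ x in convexHull ℝ (b '' {j}ᶜ), F x ∂μHE[m]) ∧
    IntegrableOn F (convexHull ℝ (b '' {i}ᶜ)) μHE[m] := by
  classical
  have hFc : Continuous F := continuous_iff_continuousAt.2 fun x => (hF x).continuousAt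
  have hw : b i - b j ≠ 0 := sub_ne_zero.2 (b.ind.injective.ne hij)
  set w := b i - b j with hwdef
  set r : ℝ := ‖w‖⁻¹ with hr
  have hr0 : 0 < r := by positivity
  set u := r • w with hudef
  have hu : ‖u‖ = 1 := norm_smul_inv_norm hw
  have hlin : ∀ k, (b.coord k).linear u =
      r * ((if k = i then 1 else 0) - if k = j then 1 else 0) := by
    intro k
    rw [hudef, hwdef, map_smul, ← vsub_eq_sub, AffineMap.linearMap_vsub, b.coord_apply,
      b.coord_apply]
    simp
  have hli : (b.coord i).linear u = r := by rw [hlin]; simp [hij]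
  have hlj : (b.coord j).linear u = -r := by rw [hlin]; simp [hij.symm]
  have hlk : ∀ k, k ≠ i → k ≠ j → (b.coord k).linear u = 0 := by
    intro k h1 h2; rw [hlin]; simp [h1, h2]
  have hcoord : ∀ k (z : V) (s : ℝ), b.coord k (z + s • u) =
      b.coord k z + s * (b.coord k).linear u := by
    intro k z s
    rw [add_comm, ← vadd_eq_add, AffineMap.map_vadd, map_smul, vadd_eq_add, smul_eq_mul, add_comm]
  have hcoord0 : ∀ k (z : V), b.coord k z = b.coord k 0 + (b.coord k).linear z := by
    intro k z
    conv_lhs => rw [← add_zero z, ← vadd_eq_add, AffineMap.map_vadd, vadd_eq_add, add_comm]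
  -- the line through `z` in direction `u` meets the face opposite `b i`, where the `i`-th
  -- barycentric coordinate vanishes, at the parameter `ci + hi z`, and the face opposite `b j` at
  -- the parameter `cj + hj z`
  set ci : ℝ := -(b.coord i 0) / r
  set hi : (ℝ ∙ u)ᗮ →ₗ[ℝ] ℝ := (-r⁻¹) • (b.coord i).linear ∘ₗ (ℝ ∙ u)ᗮ.subtype
  set cj : ℝ := (b.coord j 0) / r
  set hj : (ℝ ∙ u)ᗮ →ₗ[ℝ] ℝ := r⁻¹ • (b.coord j).linear ∘ₗ (ℝ ∙ u)ᗮ.subtype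
  have hi_eq : ∀ z : (ℝ ∙ u)ᗮ, ci + hi z = -(b.coord i (z : V)) / r := by
    intro z; rw [hcoord0 i z]; simp [ci, hi]; ring
  have hj_eq : ∀ z : (ℝ ∙ u)ᗮ, cj + hj z = (b.coord j (z : V)) / r := by
    intro z; rw [hcoord0 j z]; simp [cj, hj]; ring
  have hcell : convexHull ℝ (Set.range b) = {x | ∀ k, 0 ≤ b.coord k x} :=
    b.convexHull_eq_nonneg_coord
  -- along `u` the `i`-th coordinate increases, the `j`-th decreases, and the others are constant
  have hsec : ∀ (s : ℝ) (z : V), (∀ k, 0 ≤ b.coord k (z + s • u)) ↔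
      (∀ k, k ≠ i → k ≠ j → 0 ≤ b.coord k z) ∧ -(b.coord i z) / r ≤ s ∧ s ≤ b.coord j z / r := by
    intro s z
    constructor
    · intro h
      refine ⟨fun k h1 h2 => ?_, ?_, ?_⟩
      · have := h k; rwa [hcoord, hlk k h1 h2, mul_zero, add_zero] at this
      · have := h i; rw [hcoord, hli] at this
        rw [div_le_iff₀ hr0]; linarith
      · have := h j; rw [hcoord, hlj] at this
        rw [le_div_iff₀ hr0]; linarith
    · rintro ⟨h1, h2, h3⟩ k
      rw [div_le_iff₀ hr0] at h2
      rw [le_div_iff₀ hr0] at h3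
      rw [hcoord]
      by_cases hki : k = i
      · rw [hki, hli]; linarith
      · by_cases hkj : k = j
        · rw [hkj, hlj]; linarith
        · rw [hlk k hki hkj]; linarith [h1 k hki hkj]
  -- the common projection of the simplex and of its two faces to the hyperplane orthogonal to `u`
  set E : Set (ℝ ∙ u)ᗮ := {z | (∀ k, k ≠ i → k ≠ j → 0 ≤ b.coord k (z : V)) ∧
    -(b.coord i (z : V)) / r ≤ b.coord j (z : V) / r} with hE
  have hEi : graphMap u ci hi ⁻¹' (convexHull ℝ (b '' {i}ᶜ)) = E := by
    ext z
    rw [Set.mem_preimage, b.convexHull_image_compl_singleton, Set.mem_ofPred_eq, graphMap, hi_eq,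
      hsec, hcoord, hli, hE, Set.mem_ofPred_eq]
    constructor
    · rintro ⟨_, h1, _, h2⟩; exact ⟨h1, h2⟩
    · rintro ⟨h1, h2⟩; exact ⟨by field_simp; ring, h1, le_rfl, h2⟩
  have hEj : graphMap u cj hj ⁻¹' (convexHull ℝ (b '' {j}ᶜ)) = E := by
    ext z
    rw [Set.mem_preimage, b.convexHull_image_compl_singleton, Set.mem_ofPred_eq, graphMap, hj_eq,
      hsec, hcoord, hlj, hE, Set.mem_ofPred_eq]
    constructor
    · rintro ⟨_, h1, h2, _⟩; exact ⟨h1, h2⟩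
    · rintro ⟨h1, h2⟩; exact ⟨by field_simp; ring, h1, h2, le_rfl⟩
  have hproj : ∀ x : V, ∃ z : (ℝ ∙ u)ᗮ, ∃ s : ℝ, x = (z : V) + s • u := by
    intro x
    refine ⟨⟨x - inner ℝ u x • u, ?_⟩, inner ℝ u x, by simp⟩
    rw [Submodule.mem_orthogonal_singleton_iff_inner_right]
    simp [inner_sub_right, inner_smul_right, hu]
  have hri : convexHull ℝ (b '' {i}ᶜ) ⊆ Set.range (graphMap u ci hi) := by
    intro x hx
    rw [b.convexHull_image_compl_singleton] at hx
    obtain ⟨z, s, rfl⟩ := hproj x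
    refine ⟨z, ?_⟩
    have := hx.1
    rw [hcoord, hli] at this
    rw [graphMap, hi_eq, show -(b.coord i (z : V)) / r = s by field_simp; linarith]
  have hrj : convexHull ℝ (b '' {j}ᶜ) ⊆ Set.range (graphMap u cj hj) := by
    intro x hx
    rw [b.convexHull_image_compl_singleton] at hx
    obtain ⟨z, s, rfl⟩ := hproj x
    refine ⟨z, ?_⟩
    have := hx.1
    rw [hcoord, hlj] at this
    rw [graphMap, hj_eq, show (b.coord j (z : V)) / r = s by field_simp; linarith]
  obtain ⟨κi, hκi, hni⟩ := hn.exists_inner_eq i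
  obtain ⟨κj, hκj, hnj⟩ := hn.exists_inner_eq j
  have hnui : inner ℝ (n i) u < 0 := by rw [hni, hli]; exact mul_neg_of_neg_of_pos hκi hr0
  have hnuj : 0 < inner ℝ (n j) u := by rw [hnj, hlj]; nlinarith
  have hfin : ∀ k, IsCompact (convexHull ℝ (b '' {k}ᶜ)) := fun k =>
    ((Set.toFinite _).image b).isCompact_convexHull ℝ
  obtain ⟨hi1, hi2⟩ := setIntegral_graphMap hm hu (hn.norm_eq_one i) hnui.ne ci hi
    (by intro z
        rw [hni, map_add, map_smul, hli]
        simp [hi]; right; field_simp; ring) hri (hfin i) hFc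
  obtain ⟨hj1, -⟩ := setIntegral_graphMap hm hu (hn.norm_eq_one j) hnuj.ne' cj hj
    (by intro z
        rw [hnj, map_add, map_smul, hlj]
        simp [hj]; right; field_simp; ring) hrj (hfin j) hFc
  refine ⟨?_, hi2⟩
  rw [hEi] at hi1
  rw [hEj] at hj1
  have hEc : IsCompact E :=
    hEi ▸ (isClosedEmbedding_graphMap u ci hi).isCompact_preimage (hfin i)
  have hline := setIntegral_lineDeriv_eq hu (K := convexHull ℝ (Set.range b))
    ((Set.finite_range b).isCompact_convexHull ℝ) hEc.measurableSet
    (α := fun z => ci + hi z) (β := fun z => cj + hj z)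
    (fun z hz => by rw [hi_eq, hj_eq]; exact hz.2)
    (fun s z => by
      rw [hcell, Set.mem_ofPred_eq, add_comm, hsec, Set.mem_Icc, hi_eq, hj_eq, hE,
        Set.mem_ofPred_eq]
      exact ⟨fun ⟨h1, h2, h3⟩ => ⟨⟨h1, h2.trans h3⟩, h2, h3⟩,
        fun ⟨⟨h1, _⟩, h2, h3⟩ => ⟨h1, h2, h3⟩⟩)
    (F := F) (F' := fun x => G x u) (by fun_prop)
    (fun z s => by
      have h1 : HasDerivAt (fun s : ℝ => z + s • u) u s := by
        simpa using ((hasDerivAt_id s).smul_const u).const_add z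
      exact (hF (z + s • u)).comp_hasDerivAt s h1)
  have hcont : ∀ c (h : (ℝ ∙ u)ᗮ →ₗ[ℝ] ℝ), IntegrableOn (fun z => F (graphMap u c h z)) E := by
    intro c h
    exact (hFc.comp (isClosedEmbedding_graphMap u c h).continuous).continuousOn.integrableOn_compact
      hEc
  have hline2 : ∫ x in convexHull ℝ (Set.range b), G x u =
      inner ℝ (n j) u * ∫ x in convexHull ℝ (b '' {j}ᶜ), F x ∂μHE[m] +
      inner ℝ (n i) u * ∫ x in convexHull ℝ (b '' {i}ᶜ), F x ∂μHE[m] := by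
    rw [hline, ← abs_of_pos hnuj, ← hj1]
    have : inner ℝ (n i) u = -|inner ℝ (n i) u| := by rw [abs_of_neg hnui, neg_neg]
    rw [this, neg_mul, ← hi1]
    exact integral_sub (hcont cj hj) (hcont ci hi)
  have hwu : w = ‖w‖ • u := by
    rw [hudef, smul_smul, hr, mul_inv_cancel₀ (norm_ne_zero_iff.2 hw), one_smul]
  rw [hwu]
  simp only [map_smul, smul_eq_mul, inner_smul_right]
  rw [integral_const_mul, hline2]
  ring

/-- The divergence theorem on a simplex for the derivative of a continuously differentiable function
in a fixed direction `w`. -/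
theorem IsOuterNormals.setIntegral_fderiv {m : ℕ} (hm : finrank ℝ V = m + 1)
    {b : AffineBasis ι ℝ V} {n : ι → V} (hn : IsOuterNormals b n)
    {F : V → ℝ} {G : V → V →L[ℝ] ℝ} (hG : Continuous G) (hF : ∀ x, HasFDerivAt F (G x) x) (w : V) :
    ∫ x in convexHull ℝ (Set.range b), G x w =
      ∑ i, inner ℝ (n i) w * ∫ x in convexHull ℝ (b '' {i}ᶜ), F x ∂μHE[m] := by
  classical
  obtain ⟨j⟩ : Nonempty ι := inferInstance
  have hw : w ∈ Submodule.span ℝ (Set.range fun i => b i -ᵥ b j) := by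
    rw [← vectorSpan_range_eq_span_range_vsub_right, ← direction_affineSpan, b.tot,
      AffineSubspace.direction_top]
    trivial
  have hint : ∀ v, IntegrableOn (fun x => G x v) (convexHull ℝ (Set.range b)) := fun v =>
    (by fun_prop : Continuous fun x => G x v).continuousOn.integrableOn_compact
      ((Set.finite_range b).isCompact_convexHull ℝ)
  induction hw using Submodule.span_induction with
  | mem x hx =>
    obtain ⟨i, rfl⟩ := hx
    simp only [vsub_eq_sub]
    by_cases hij : i = j
    · simp [hij]
    rw [(hn.setIntegral_edge hm hij hG hF).1, Finset.sum_eq_add i j hij ?_ (by simp) (by simp)]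
    rintro k - ⟨hki, hkj⟩
    rw [hn.orthogonal k i j hki.symm hkj.symm, zero_mul]
  | zero => simp
  | add x y _ _ hx hy =>
    simp only [map_add, inner_add_right, add_mul, Finset.sum_add_distrib]
    rw [integral_add (hint x) (hint y), hx, hy]
  | smul c x _ hx =>
    simp only [map_smul, smul_eq_mul, inner_smul_right, mul_assoc]
    rw [integral_const_mul, hx, Finset.mul_sum]

end Divergence

/-! ### Polynomial fields on simplices -/

section Polynomials

variable {d : ℕ}

theorem evalAt_continuous (q : Poly d) : Continuous (evalAt q) :=
  (MvPolynomial.continuous_eval q).comp (by fun_prop)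

theorem hasFDerivAt_evalAt (q : Poly d) (x : Pt d) :
    HasFDerivAt (evalAt q) (∑ i, gradAt q x i • (EuclideanSpace.proj i : Pt d →L[ℝ] ℝ)) x := by
  induction q using MvPolynomial.induction_on with
  | C a =>
    have h : evalAt (MvPolynomial.C a : Poly d) = fun _ => a := by ext y; simp [evalAt]
    rw [h]
    simpa [evalAt, gradAt] using hasFDerivAt_const a x
  | add p q hp hq =>
    convert! hp.add hq using 1
    · ext y; simp [evalAt]
    · simp [gradAt, evalAt, add_smul, Finset.sum_add_distrib]
  | mul_X p j hp =>
    have h := hp.mul (EuclideanSpace.proj j : Pt d →L[ℝ] ℝ).hasFDerivAt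
    convert! h using 1
    · ext y; simp [evalAt]
    · ext v
      simp [gradAt, evalAt, MvPolynomial.pderiv_X, Pi.single_apply,
        add_mul, Finset.sum_add_distrib, apply_ite (MvPolynomial.eval fun i => x i), Finset.mul_sum,
        mul_assoc]

/-- The divergence of a polynomial vector field. -/
def divAt (U : Fin d → Poly d) (x : Pt d) : ℝ := ∑ i, gradAt (U i) x i

theorem gradAt_continuous (q : Poly d) (i : Fin d) : Continuous fun x => gradAt q x i :=
  evalAt_continuous _

theorem divAt_continuous (U : Fin d → Poly d) : Continuous (divAt U) :=
  continuous_finsetSum _ fun i _ => gradAt_continuous _ i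

end Polynomials

section Simplices

variable {d : ℕ}

theorem isCompact_cell (t : Finset (Pt d)) : IsCompact (cell t) :=
  t.finite_toSet.isCompact_convexHull ℝ

theorem facesOf_eq_image_erase {t : Finset (Pt d)} (ht : t.card = d + 1) [DecidableEq (Pt d)] :
    facesOf t = t.image t.erase := by
  ext e
  rw [facesOf, Finset.mem_powersetCard, Finset.mem_image]
  constructor
  · rintro ⟨h1, h2⟩
    have h3 : (t \ e).card = 1 := by rw [Finset.card_sdiff_of_subset h1]; omega
    obtain ⟨v, hv⟩ := Finset.card_eq_one.1 h3
    have hvt : v ∈ t \ e := by rw [hv]; simp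
    refine ⟨v, (Finset.mem_sdiff.1 hvt).1, ?_⟩
    rw [Finset.erase_eq, ← hv, Finset.sdiff_sdiff_eq_self h1]
  · rintro ⟨v, hv, rfl⟩
    exact ⟨Finset.erase_subset _ _, by rw [Finset.card_erase_of_mem hv]; omega⟩

/-- The divergence theorem for a polynomial field on a nondegenerate simplex, for any choice `N` of
outer unit normals on its faces. -/
theorem setIntegral_divAt_cell (hd : 1 ≤ d) {t : Finset (Pt d)} (ht : t.card = d + 1)
    (hind : AffineIndependent ℝ ((↑) : t → Pt d)) (N : Finset (Pt d) → Pt d)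
    (hN1 : ∀ e ∈ facesOf t, ‖N e‖ = 1)
    (hN2 : ∀ e ∈ facesOf t, ∀ x ∈ e, ∀ y ∈ e, inner ℝ (N e) (y - x) = 0)
    (hN3 : ∀ e ∈ facesOf t, ∀ x ∈ e, ∀ a ∈ t, a ∉ e → inner ℝ (N e) (a - x) < 0)
    (U : Fin d → Poly d) :
    ∫ x in cell t, divAt U x =
      ∑ e ∈ facesOf t, faceIntegral e (fun x => vecAt U x ⬝ᵥ fun i => N e i) := by
  classical
  obtain ⟨m, rfl⟩ : ∃ m, d = m + 1 := ⟨d - 1, by omega⟩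
  have htot : affineSpan ℝ (Set.range ((↑) : t → Pt (m + 1))) = ⊤ := by
    rw [hind.affineSpan_eq_top_iff_card_eq_finrank_add_one]
    simp [ht]
  let b : AffineBasis t ℝ (Pt (m + 1)) := ⟨(↑), hind, htot⟩
  have hb : ∀ v : t, b v = v := fun _ => rfl
  have hmem : ∀ v : t, t.erase v ∈ facesOf t := fun v => by
    rw [facesOf_eq_image_erase ht]; exact Finset.mem_image_of_mem _ v.2
  have hn : IsOuterNormals b fun v => N (t.erase v) :=
    { norm_eq_one := fun v => hN1 _ (hmem v)
      orthogonal := fun v x y hx hy => hN2 _ (hmem v) _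
        (Finset.mem_erase.2 ⟨fun h => hy (Subtype.ext h), y.2⟩) _
        (Finset.mem_erase.2 ⟨fun h => hx (Subtype.ext h), x.2⟩)
      outward := fun v y hy => hN3 _ (hmem v) _
        (Finset.mem_erase.2 ⟨fun h => hy (Subtype.ext h), y.2⟩) _ v.2 (Finset.notMem_erase _ _) }
  have hnt : Nontrivial t := by
    rw [← Fintype.one_lt_card_iff_nontrivial]; simp [ht]
  have hcell : convexHull ℝ (Set.range b) = cell t := by
    rw [cell]; congr 1; exact Subtype.range_coe
  have hface : ∀ v : t, convexHull ℝ (b '' {v}ᶜ) = cell (t.erase v) := by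
    intro v
    rw [cell]; congr 1
    ext x
    simp only [Set.mem_image, Set.mem_compl_iff, Set.mem_singleton_iff, Finset.coe_erase,
      Set.mem_sdiff, Finset.mem_coe, hb]
    constructor
    · rintro ⟨y, hy, rfl⟩; exact ⟨y.2, fun h => hy (Subtype.ext h)⟩
    · rintro ⟨h1, h2⟩; exact ⟨⟨x, h1⟩, fun h => h2 (congrArg Subtype.val h), rfl⟩
  have hfin : finrank ℝ (Pt (m + 1)) = m + 1 := by simp
  have hG : ∀ q : Poly (m + 1), Continuous fun x : Pt (m + 1) =>
      ∑ i, gradAt q x i • (EuclideanSpace.proj i : Pt (m + 1) →L[ℝ] ℝ) := fun q =>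
    continuous_finsetSum _ fun i _ => (gradAt_continuous q i).smul continuous_const
  have hint : ∀ (q : Poly (m + 1)) (v : t),
      IntegrableOn (evalAt q) (cell (t.erase v)) μHE[m] := by
    intro q v
    obtain ⟨w, hw⟩ := exists_ne v
    rw [← hface]
    exact (hn.setIntegral_edge hfin hw.symm (hG q) (hasFDerivAt_evalAt q)).2
  have hdiv : ∀ i : Fin (m + 1), ∫ x in cell t, gradAt (U i) x i =
      ∑ v : t, N (t.erase v) i * ∫ x in cell (t.erase v), evalAt (U i) x ∂μHE[m] := by
    intro i
    have := hn.setIntegral_fderiv hfin (hG (U i)) (hasFDerivAt_evalAt (U i))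
      (EuclideanSpace.single i 1)
    simp only [hcell, hface] at this
    simpa [Pi.single_apply, EuclideanSpace.inner_single_right] using this
  rw [facesOf_eq_image_erase ht, Finset.sum_image (fun x hx y hy h => Finset.erase_injOn t hx hy h),
    ← Finset.sum_coe_sort t]
  simp only [divAt]
  rw [integral_finsetSum _ fun i _ =>
    (gradAt_continuous (U i) i).continuousOn.integrableOn_compact (isCompact_cell t)]
  simp only [hdiv]
  rw [Finset.sum_comm]
  refine Finset.sum_congr rfl fun v _ => ?_
  simp only [faceIntegral, dotProduct, vecAt, Nat.add_sub_cancel]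
  rw [integral_finsetSum _ fun i _ => (hint (U i) v).mul_const _]
  refine Finset.sum_congr rfl fun i _ => ?_
  rw [integral_mul_const, mul_comm]

/-! ### Fine elements and the weak divergence -/

/-- Two fine elements overlap in the hull of their common vertices, which lies in a proper affine
subspace. -/
theorem volume_cell_inter_cell {Ω : Set (Pt d)} (τ : Triangulation Ω) {s t : Finset (Pt d)}
    (hs : s ∈ τ.elems) (ht : t ∈ τ.elems) (hst : s ≠ t) : volume (cell s ∩ cell t) = 0 := by
  classical
  rw [τ.conforming s hs t ht]
  obtain ⟨v, hvs, hvt⟩ : ∃ v ∈ s, v ∉ t := by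
    by_contra! h
    exact hst (Finset.eq_of_subset_of_card_le h (by rw [τ.card_eq s hs, τ.card_eq t ht]))
  refine measure_mono_null (convexHull_subset_affineSpan _)
    (addHaar_affineSubspace _ _ fun htop => ?_)
  have himg : ((s : Set (Pt d)) ∩ t) = ((↑) : s → Pt d) '' {x | (x : Pt d) ∈ t} := by
    ext x
    simp
    tauto
  have := (τ.indep s hs).mem_affineSpan_iff ⟨v, hvs⟩ {x | (x : Pt d) ∈ t}
  rw [← himg, htop] at this
  exact hvt (this.1 trivial)

theorem interior_cell_ae_eq (t : Finset (Pt d)) : interior (cell t) =ᵐ[volume] cell t :=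
  interior_ae_eq_of_null_frontier ((convex_convexHull ℝ _).addHaar_frontier volume)

variable {Ω : Set (Pt d)}

theorem interior_cell_subset (hΩ : IsBoundedDomain Ω) (τ : Triangulation Ω) {t : Finset (Pt d)}
    (ht : t ∈ τ.elems) : interior (cell t) ⊆ Ω := by
  rw [← hΩ.interior_closure, ← τ.cover]
  exact interior_mono (Set.subset_biUnion_of_mem (u := cell) ht)

theorem integrableOn_cell (hΩ : IsBoundedDomain Ω) (τ : Triangulation Ω) {t : Finset (Pt d)}
    (ht : t ∈ τ.elems) {g : Pt d → ℝ} (hg : MemLp g 2 (volume.restrict Ω)) :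
    IntegrableOn g (cell t) := by
  have : IsFiniteMeasure (volume.restrict Ω) := ⟨by
    rw [Measure.restrict_apply_univ]; exact hΩ.isBounded.measure_lt_top⟩
  have h1 : IntegrableOn g Ω := hg.integrable (by norm_num)
  exact (h1.mono_set (interior_cell_subset hΩ τ ht)).congr_set_ae (interior_cell_ae_eq t).symm

/-- A weak divergence of a field that is polynomial on a fine element has there the integral of the
classical divergence: test functions supported inside the element see only the polynomial field. -/
theorem HasWeakDiv.setIntegral_cell (hΩ : IsBoundedDomain Ω) (τ : Triangulation Ω)
    {t : Finset (Pt d)} (ht : t ∈ τ.elems) {u : Pt d → Pt d} {g : Pt d → ℝ}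
    (hg : HasWeakDiv Ω u g) {U : Fin d → Poly d}
    (hU : ∀ᵐ x ∂(volume.restrict (cell t)), ∀ i, u x i = vecAt U x i) :
    ∫ x in cell t, g x = ∫ x in cell t, divAt U x := by
  have hgt := integrableOn_cell hΩ τ ht hg.memLp_div
  have hdt : IntegrableOn (divAt U) (cell t) :=
    (divAt_continuous U).continuousOn.integrableOn_compact (isCompact_cell t)
  set W := interior (cell t)
  have hWΩ : W ⊆ Ω := interior_cell_subset hΩ τ ht
  have hae : ∀ᵐ x, x ∈ W → g x - divAt U x = 0 := by
    refine isOpen_interior.ae_eq_zero_of_integral_contDiff_smul_eq_zero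
      ((hgt.sub hdt).mono_set interior_subset).locallyIntegrableOn fun φ hφ hφc hφW => ?_
    have hφ0 : ∀ x, x ∉ W → φ x = 0 := fun x hx =>
      image_eq_zero_of_notMem_tsupport fun h => hx (hφW h)
    have hdφ0 : ∀ x, x ∉ W → fderiv ℝ φ x = 0 := fun x hx =>
      image_eq_zero_of_notMem_tsupport fun h => hx (hφW (tsupport_fderiv_subset ℝ h))
    have hφcont : Continuous φ := hφ.continuous
    have hdiff : Differentiable ℝ φ := hφ.differentiable (by simp)
    have hdcont : Continuous (fderiv ℝ φ) := hφ.continuous_fderiv (by simp)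
    have hdsupp : HasCompactSupport (fderiv ℝ φ) := hφc.fderiv ℝ
    have hw := hg.weak φ hφ hφc (hφW.trans hWΩ)
    -- on the support of the test function the field is the polynomial field
    have hL : ∫ x in Ω, inner ℝ (u x) (gradient φ x) =
        ∑ i, ∫ x, evalAt (U i) x * fderiv ℝ φ x (EuclideanSpace.single i 1) := by
      have h1 : ∫ x in Ω, inner ℝ (u x) (gradient φ x) =
          ∫ x in W, inner ℝ (u x) (gradient φ x) := by
        refine setIntegral_eq_of_subset_of_forall_sdiff_eq_zero hΩ.isOpen.measurableSet hWΩ ?_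
        rintro x ⟨-, hx⟩
        simp [inner_gradient_right, hdφ0 x hx]
      have h2 : ∫ x in W, inner ℝ (u x) (gradient φ x) =
          ∫ x in W, ∑ i, evalAt (U i) x * fderiv ℝ φ x (EuclideanSpace.single i 1) := by
        refine integral_congr_ae ?_
        filter_upwards [ae_restrict_of_ae_restrict_of_subset interior_subset hU] with x hx
        have hux : u x = ∑ i, evalAt (U i) x • EuclideanSpace.single i (1 : ℝ) := by
          ext i
          rw [hx i]
          simp [vecAt, Pi.single_apply]
        rw [inner_gradient_right, hux]
        simp
      have h3 : ∫ x in W, ∑ i, evalAt (U i) x * fderiv ℝ φ x (EuclideanSpace.single i 1) =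
          ∫ x, ∑ i, evalAt (U i) x * fderiv ℝ φ x (EuclideanSpace.single i 1) :=
        setIntegral_eq_integral_of_forall_compl_eq_zero fun x hx => by simp [hdφ0 x hx]
      rw [h1, h2, h3, integral_finsetSum]
      intro i _
      refine Continuous.integrable_of_hasCompactSupport ?_ ?_
      · have := evalAt_continuous (U i)
        fun_prop
      · exact HasCompactSupport.mul_left
          (hdsupp.comp_left (g := fun L : Pt d →L[ℝ] ℝ => L (EuclideanSpace.single i 1)) rfl)
    have hparts : ∀ i, ∫ x, evalAt (U i) x * fderiv ℝ φ x (EuclideanSpace.single i 1) =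
        - ∫ x, gradAt (U i) x i * φ x := by
      intro i
      have hfd : ∀ x, fderiv ℝ (evalAt (U i)) x (EuclideanSpace.single i 1) = gradAt (U i) x i := by
        intro x
        rw [(hasFDerivAt_evalAt (U i) x).fderiv]
        simp
      have hc1 := evalAt_continuous (U i)
      have hc2 := gradAt_continuous (U i) i
      rw [integral_mul_fderiv_eq_neg_fderiv_mul_of_integrable]
      · simp only [hfd]
      · simp only [hfd]
        exact (hc2.mul hφcont).integrable_of_hasCompactSupport hφc.mul_left
      · refine Continuous.integrable_of_hasCompactSupport (by fun_prop) ?_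
        exact HasCompactSupport.mul_left
          (hdsupp.comp_left (g := fun L : Pt d →L[ℝ] ℝ => L (EuclideanSpace.single i 1)) rfl)
      · exact (hc1.mul hφcont).integrable_of_hasCompactSupport hφc.mul_left
      · exact fun x _ => (hasFDerivAt_evalAt (U i) x).differentiableAt
      · exact fun x _ => hdiff x
    have hR : ∫ x in Ω, g x * φ x = ∫ x, g x * φ x :=
      setIntegral_eq_integral_of_forall_compl_eq_zero fun x hx => by
        rw [hφ0 x fun h => hx (hWΩ h), mul_zero]
    have hdivφ : ∫ x, divAt U x * φ x = ∑ i, ∫ x, gradAt (U i) x i * φ x := by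
      simp only [divAt, Finset.sum_mul]
      refine integral_finsetSum _ fun i _ => ?_
      exact ((gradAt_continuous (U i) i).mul hφcont).integrable_of_hasCompactSupport hφc.mul_left
    have hgφ : Integrable fun x => g x * φ x := by
      have h1 : IntegrableOn (fun x => g x * φ x) (cell t) :=
        hgt.mul_continuousOn hφcont.continuousOn (isCompact_cell t)
      refine (integrableOn_iff_integrable_of_support_subset fun x hx => ?_).1 h1
      by_contra hxt
      exact hx (by simp only [hφ0 x fun h => hxt (interior_subset h), mul_zero])
    have hdφ : Integrable fun x => divAt U x * φ x :=
      ((divAt_continuous U).mul hφcont).integrable_of_hasCompactSupport hφc.mul_left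
    simp only [smul_eq_mul, mul_comm (φ _), sub_mul]
    rw [integral_sub hgφ hdφ, hdivφ, ← hR, sub_eq_zero]
    rw [hL] at hw
    simp only [hparts, Finset.sum_neg_distrib] at hw
    linarith
  rw [← setIntegral_congr_set (interior_cell_ae_eq t),
    ← setIntegral_congr_set (interior_cell_ae_eq t)]
  refine setIntegral_congr_ae isOpen_interior.measurableSet ?_
  filter_upwards [hae] with x hx hxW
  linarith [hx hxW]

theorem setIntegral_region (hΩ : IsBoundedDomain Ω) {τ : Triangulation Ω} {ι : Type*}
    (C : CoarsePartition τ ι) (T : ι) {g : Pt d → ℝ} (hg : MemLp g 2 (volume.restrict Ω)) :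
    ∫ x in C.region T, g x = ∑ t ∈ C.cells T, ∫ x in cell t, g x := by
  classical
  have hmem : ∀ t : C.cells T, t.1 ∈ τ.elems := fun t =>
    (Finset.mem_filter.1 (show t.1 ∈ τ.elems.filter _ from t.2)).1
  have hreg : C.region T = ⋃ t : C.cells T, cell t.1 := by ext x; simp [CoarsePartition.region]
  rw [hreg]
  rw [integral_iUnion_ae (fun t => (isCompact_cell _).measurableSet.nullMeasurableSet)
    (fun s t hst => volume_cell_inter_cell τ (hmem s) (hmem t) fun h => hst (Subtype.ext h))
    (by rw [integrableOn_finite_iUnion]; exact fun t => integrableOn_cell hΩ τ (hmem t) hg),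
    tsum_fintype, ← Finset.sum_coe_sort (C.cells T)]

end Simplices

/-! ### Fine faces and their orientation -/

section Faces

variable {d : ℕ} {Ω : Set (Pt d)} {τ : Triangulation Ω}

theorem Triangulation.mem_faces_iff {e : Finset (Pt d)} :
    e ∈ τ.faces ↔ ∃ t ∈ τ.elems, e ∈ facesOf t := by
  classical
  simp [Triangulation.faces]

theorem Triangulation.mem_facesOf_iff {e t : Finset (Pt d)} (he : e ∈ τ.faces) :
    e ∈ facesOf t ↔ e ⊆ t := by
  obtain ⟨s, -, hs⟩ := Triangulation.mem_faces_iff.1 he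
  rw [facesOf, Finset.mem_powersetCard] at hs ⊢
  exact ⟨fun h => h.1, fun h => ⟨h, hs.2⟩⟩

theorem CoarsePartition.mem_cells_iff {ι : Type*} (C : CoarsePartition τ ι) {T : ι}
    {t : Finset (Pt d)} : t ∈ C.cells T ↔ t ∈ τ.elems ∧ C.part t = T := by
  classical
  simp [CoarsePartition.cells]

theorem CoarsePartition.mem_innerFaces_iff {ι : Type*} (C : CoarsePartition τ ι) {T : ι}
    {e : Finset (Pt d)} : e ∈ C.innerFaces T ↔ e ∈ τ.faces ∧ C.IsInnerOf T e := by
  classical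
  simp [CoarsePartition.innerFaces]

theorem CoarsePartition.mem_skeleton_iff {ι : Type*} (C : CoarsePartition τ ι)
    {e : Finset (Pt d)} : e ∈ C.skeleton ↔ e ∈ τ.faces ∧ ∀ T, ¬ C.IsInnerOf T e := by
  classical
  simp [CoarsePartition.skeleton]

theorem Orientation.eq_neg_of_not_isInner (O : Orientation τ) {e t : Finset (Pt d)}
    (he : e ∈ τ.faces) (hi : ¬ τ.IsInner e) (ht : t ∈ τ.elems) (het : e ⊆ t) : t = O.neg e := by
  by_contra h
  exact hi ⟨he, t, ht, O.neg e, (O.neg_spec e he).1, h, het, (O.neg_spec e he).2⟩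

open scoped Classical in
/-- The factor that turns `n_e` into the outer normal of the adjacent element `t`: it is `1` for
`t = t⁻` and `-1` otherwise, that is, for `t = t⁺`. -/
def Orientation.sign (O : Orientation τ) (t e : Finset (Pt d)) : ℝ := if t = O.neg e then 1 else -1

/-- The divergence theorem on a fine element, with the fixed normals `n_e` of the faces. -/
theorem setIntegral_divAt_elem (hd : 1 ≤ d) (O : Orientation τ) {t : Finset (Pt d)}
    (ht : t ∈ τ.elems) (U : Fin d → Poly d) :
    ∫ x in cell t, divAt U x = ∑ e ∈ facesOf t, O.sign t e *
      faceIntegral e (fun x => vecAt U x ⬝ᵥ fun i => O.normal e i) := by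
  have hface : ∀ e ∈ facesOf t, e ∈ τ.faces := fun e he =>
    Triangulation.mem_faces_iff.2 ⟨t, ht, he⟩
  have hsub : ∀ e ∈ facesOf t, e ⊆ t := fun e he => (Finset.mem_powersetCard.1 he).1
  have hpos : ∀ e ∈ facesOf t, t ≠ O.neg e → τ.IsInner e ∧ t = O.pos e := by
    intro e he h
    have hi : τ.IsInner e := by
      by_contra hi
      exact h (O.eq_neg_of_not_isInner (hface e he) hi ht (hsub e he))
    exact ⟨hi, (O.adjacent e hi t ht (hsub e he)).resolve_left h⟩
  rw [setIntegral_divAt_cell hd (τ.card_eq t ht) (τ.indep t ht) (fun e => O.sign t e • O.normal e)]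
  · refine Finset.sum_congr rfl fun e _ => ?_
    rw [faceIntegral, faceIntegral, ← integral_const_mul]
    congr 1
    ext x
    rw [← smul_eq_mul, ← dotProduct_smul]
    rfl
  · intro e he
    rw [norm_smul, O.norm_normal e (hface e he), Orientation.sign]
    split_ifs <;> simp
  · intro e he x hx y hy
    rw [inner_smul_left, O.normal_orth e (hface e he) x hx y hy, mul_zero]
  · intro e he x hx a ha hae
    rw [inner_smul_left, Orientation.sign]
    split_ifs with h
    · simpa using O.normal_neg e (hface e he) x hx a (h ▸ ha) hae
    · obtain ⟨hi, h'⟩ := hpos e he h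
      simpa using O.normal_pos e hi x hx a (h' ▸ ha) hae

end Faces

/-! ### Testing with the characteristic function of a coarse element -/

namespace Scheme

variable {d : ℕ} {Ω : Set (Pt d)} {ι ι' P : Type*} (S : Scheme Ω ι ι' P)

open scoped Classical in
/-- The characteristic function of the coarse element `T`. -/
def coarseIndicator (T : ι) : Broken d := fun t => if S.C.part t = T then 1 else 0

theorem gradAt_coarseIndicator (T : ι) (t : Finset (Pt d)) (x : Pt d) :
    gradAt (S.coarseIndicator T t) x = 0 := by
  ext i
  unfold coarseIndicator
  split_ifs <;> simp [gradAt, evalAt]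

open scoped Classical in
/-- The jump `⟦1_T⟧_e` of the characteristic function of `T`, a constant on `e`. -/
def coarseJump (T : ι) (e : Finset (Pt d)) : ℝ :=
  (if S.C.part (S.O.neg e) = T then 1 else 0) -
    if S.τ.IsInner e ∧ S.C.part (S.O.pos e) = T then 1 else 0

theorem jump_coarseIndicator (T : ι) (e : Finset (Pt d)) (x : Pt d) :
    S.jump (S.coarseIndicator T) e x = S.coarseJump T e := by
  unfold jump coarseJump coarseIndicator
  split_ifs <;> simp_all [evalAt]

theorem coarseJump_of_isInnerOf {T T' : ι} {e : Finset (Pt d)} (h : S.C.IsInnerOf T' e) :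
    S.coarseJump T e = 0 := by
  have h1 := h.2 _ (S.O.neg_spec e h.1.1).1 (S.O.neg_spec e h.1.1).2
  have h2 := h.2 _ (S.O.pos_spec e h.1).1 (S.O.pos_spec e h.1).2.1
  have hi : S.τ.IsInner e := h.1
  unfold coarseJump
  rw [h1, h2]
  by_cases hT : T' = T
  · rw [if_pos hT, if_pos ⟨hi, hT⟩, sub_self]
  · rw [if_neg hT, if_neg fun hc => hT hc.2, sub_self]

/-- The numerical flux `∫_e (-⦃(λ κ ∇_h p) · n_e⦄ + σ_e ⟦p⟧)` of `p` through the face `e`. -/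
def faceFlux (μ : P) (e : Finset (Pt d)) (p : Broken d) : ℝ :=
  S.coupling μ e p (evalAt 1) + S.penalization μ e p (evalAt 1)

/-- The face terms of `b_h(p, 1_T)`; the factor `c` of the symmetrizing term plays no role because
`1_T` has no diffusive flux. -/
theorem face_form_coarseIndicator (μ : P) (T : ι) (c : ℝ) (e : Finset (Pt d)) (p : Broken d) :
    c * S.bc μ e (S.coarseIndicator T) p + S.bc μ e p (S.coarseIndicator T) +
      S.bp μ e (S.coarseIndicator T) p = S.coarseJump T e * S.faceFlux μ e p := by
  have h1 : S.bc μ e (S.coarseIndicator T) p = 0 := by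
    simp [bc, coupling, fluxAvg, flux, gradAt_coarseIndicator, faceIntegral]
  have h2 : S.bc μ e p (S.coarseIndicator T) = S.coarseJump T e * S.coupling μ e p (evalAt 1) := by
    simp only [bc, coupling, faceIntegral, jump_coarseIndicator]
    rw [← integral_const_mul]
    simp [evalAt, mul_comm]
  have h3 : S.bp μ e (S.coarseIndicator T) p =
      S.coarseJump T e * S.penalization μ e p (evalAt 1) := by
    simp only [bp, penalization, faceIntegral, jump_coarseIndicator]
    rw [← integral_const_mul]
    congr 1
    ext x
    simp [evalAt]
    ring
  rw [h1, h2, h3, faceFlux]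
  ring

theorem bh_coarseIndicator [Fintype ι] [Fintype ι'] (μ : P) (p : Broken d) (T : ι) :
    S.bh μ p (S.coarseIndicator T) = ∑ e ∈ S.C.skeleton, S.coarseJump T e * S.faceFlux μ e p := by
  classical
  have hloc : ∀ T', S.bhLocal μ T' p (S.coarseIndicator T) = 0 := by
    intro T'
    simp only [bhLocal, face_form_coarseIndicator]
    rw [Finset.sum_eq_zero fun e he => ?_]
    · simp [bLocal, bCell, gradAt_coarseIndicator]
    · rw [S.coarseJump_of_isInnerOf (S.C.mem_innerFaces_iff.1 he).2, zero_mul]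
  have hface : ∀ E, S.bhFace μ E p (S.coarseIndicator T) =
      ∑ e ∈ S.C.skeleton with S.F.label e = E, S.coarseJump T e * S.faceFlux μ e p := by
    intro E
    simp only [bhFace]
    refine Finset.sum_congr rfl fun e _ => ?_
    rw [← S.face_form_coarseIndicator μ T 1, one_mul]
  simp only [bh, hloc, hface, Finset.sum_const_zero, zero_add]
  exact Finset.sum_fiberwise _ _ _

theorem rhs_coarseIndicator [Fintype ι] (T : ι) :
    S.rhs (S.coarseIndicator T) = ∑ t ∈ S.C.cells T, ∫ x in cell t, S.f x := by
  classical
  rw [rhs, Finset.sum_eq_single T]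
  · refine Finset.sum_congr rfl fun t ht => ?_
    simp [coarseIndicator, (S.C.mem_cells_iff.1 ht).2, evalAt]
  · intro T' _ hT'
    refine Finset.sum_eq_zero fun t ht => ?_
    simp [coarseIndicator, (S.C.mem_cells_iff.1 ht).2, hT', evalAt]
  · simp

/-- The elements of `T` adjacent to a face contribute with opposite signs, which adds up to the jump
of `1_T`. -/
theorem sum_sign_cells (T : ι) {e : Finset (Pt d)} (he : e ∈ S.τ.faces) [DecidableEq (Pt d)] :
    ∑ t ∈ S.C.cells T with e ⊆ t, S.O.sign t e = S.coarseJump T e := by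
  classical
  have hneg := S.O.neg_spec e he
  by_cases hi : S.τ.IsInner e
  · obtain ⟨hp1, hp2, hp3⟩ := S.O.pos_spec e hi
    have hset : (S.C.cells T).filter (e ⊆ ·) =
        ({S.O.neg e, S.O.pos e} : Finset _).filter (S.C.part · = T) := by
      ext t
      simp only [Finset.mem_filter, S.C.mem_cells_iff, Finset.mem_insert, Finset.mem_singleton]
      constructor
      · rintro ⟨⟨h1, h2⟩, h3⟩; exact ⟨S.O.adjacent e hi t h1 h3, h2⟩
      · rintro ⟨rfl | rfl, h2⟩
        · exact ⟨⟨hneg.1, h2⟩, hneg.2⟩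
        · exact ⟨⟨hp1, h2⟩, hp2⟩
    rw [hset, Finset.sum_filter, Finset.sum_pair hp3.symm]
    simp only [Orientation.sign, coarseJump, hi, hp3, true_and, if_true, if_false]
    split_ifs <;> simp
  · have hset : (S.C.cells T).filter (e ⊆ ·) =
        ({S.O.neg e} : Finset _).filter (S.C.part · = T) := by
      ext t
      simp only [Finset.mem_filter, S.C.mem_cells_iff, Finset.mem_singleton]
      constructor
      · rintro ⟨⟨h1, h2⟩, h3⟩; exact ⟨S.O.eq_neg_of_not_isInner he hi h1 h3, h2⟩
      · rintro ⟨rfl, h2⟩; exact ⟨⟨hneg.1, h2⟩, hneg.2⟩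
    rw [hset, Finset.sum_filter, Finset.sum_singleton]
    simp [Orientation.sign, coarseJump, hi]

/-- Summing the outward fluxes over the fine elements of `T` cancels the faces in the interior of
`T`. -/
theorem sum_sign_faceFlux (μ : P) (p : Broken d) (T : ι) :
    ∑ t ∈ S.C.cells T, ∑ e ∈ facesOf t, S.O.sign t e * S.faceFlux μ e p =
      ∑ e ∈ S.C.skeleton, S.coarseJump T e * S.faceFlux μ e p := by
  classical
  have hsk : S.C.skeleton ⊆ S.τ.faces := fun e he => (S.C.mem_skeleton_iff.1 he).1
  rw [Finset.sum_subset hsk fun e he hes => ?_]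
  · rw [Finset.sum_comm' (t' := S.τ.faces) (s' := fun e => (S.C.cells T).filter (e ⊆ ·))]
    · exact Finset.sum_congr rfl fun e he => by rw [← Finset.sum_mul, S.sum_sign_cells T he]
    · intro t e
      rw [Finset.mem_filter]
      constructor
      · rintro ⟨h1, h2⟩
        have he : e ∈ S.τ.faces :=
          Triangulation.mem_faces_iff.2 ⟨t, (S.C.mem_cells_iff.1 h1).1, h2⟩
        exact ⟨⟨h1, (Triangulation.mem_facesOf_iff he).1 h2⟩, he⟩
      · rintro ⟨⟨h1, h2⟩, he⟩
        exact ⟨h1, (Triangulation.mem_facesOf_iff he).2 h2⟩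
  · have : ∃ T', S.C.IsInnerOf T' e := by
      by_contra! h
      exact hes (S.C.mem_skeleton_iff.2 ⟨he, h⟩)
    obtain ⟨T', hT'⟩ := this
    rw [S.coarseJump_of_isInnerOf hT', zero_mul]

/-- A flux reconstruction of any `p` that satisfies the discrete equation for the test functions
`1_T` is locally conservative. -/
theorem IsFluxReconstruction.locallyConservative [Fintype ι] [Fintype ι'] (hd : 1 ≤ d)
    (hΩ : IsBoundedDomain Ω) {S : Scheme Ω ι ι' P} {l : ℕ} {μ : P} {p : Broken d} {u : Pt d → Pt d}
    (hu : S.IsFluxReconstruction l μ p u)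
    (hp : ∀ T, S.bh μ p (S.coarseIndicator T) = S.rhs (S.coarseIndicator T)) :
    S.LocallyConservative u := by
  obtain ⟨U, hU, hface, -⟩ := hu
  refine ⟨hU.inHDiv, fun g hg T => ?_⟩
  rw [setIntegral_region hΩ S.C T hg.memLp_div, setIntegral_region hΩ S.C T S.f_memLp,
    ← S.rhs_coarseIndicator, ← hp, S.bh_coarseIndicator, ← S.sum_sign_faceFlux]
  refine Finset.sum_congr rfl fun t ht => ?_
  have hte := (S.C.mem_cells_iff.1 ht).1
  rw [hg.setIntegral_cell hΩ S.τ hte (hU.ae_eq t hte), setIntegral_divAt_elem hd S.O hte]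
  refine Finset.sum_congr rfl fun e he => ?_
  have h1 : (1 : Poly d) ∈ PolyDeg d l := by
    rw [MvPolynomial.mem_restrictTotalDegree]; simp
  rw [faceFlux, ← hface t hte e he 1 h1]
  simp [evalAt]

theorem restr_coarseIndicator_mem {Q : ∀ T : ι, Submodule ℝ (S.C.cells T → Poly d)}
    (hQ : ∀ T, (1 : S.C.cells T → Poly d) ∈ Q T) (T T' : ι) :
    S.restr T' (S.coarseIndicator T) ∈ Q T' := by
  by_cases h : T' = T
  · convert hQ T' using 1
    ext1 t
    simp [restr, coarseIndicator, (S.C.mem_cells_iff.1 t.2).2, h]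
  · convert (Q T').zero_mem using 1
    ext1 t
    simp [restr, coarseIndicator, (S.C.mem_cells_iff.1 t.2).2, h]

end Scheme
end LRBMS

end

theorem mainTheorem4 {d : ℕ} (hd : d = 2 ∨ d = 3)
    {ι ι' P : Type*} [Fintype ι] [Fintype ι']
    (Ω : Set (LRBMS.Pt d)) (hΩ : LRBMS.IsBoundedDomain Ω)
    (S : LRBMS.Scheme Ω ι ι' P)
    (k l : ℕ) (hk : 1 ≤ k) (hkl : k - 1 ≤ l) (hlk : l ≤ k)
    (Qred : ∀ T : ι, Submodule ℝ (S.C.cells T → LRBMS.Poly d))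
    (hsub : ∀ T, Qred T ≤ S.localSpace k T)
    (hone : ∀ T, (1 : S.C.cells T → LRBMS.Poly d) ∈ Qred T)
    (μ : P)
    (p_h p_red : LRBMS.Broken d)
    (hp_h : S.IsDGSolution k μ p_h)
    (hp_red : S.IsReducedSolution k Qred μ p_red)
    (u_h u_red : LRBMS.Pt d → LRBMS.Pt d)
    (hu_h : S.IsFluxReconstruction l μ p_h u_h)
    (hu_red : S.IsFluxReconstruction l μ p_red u_red) :
    S.LocallyConservative u_h ∧ S.LocallyConservative u_red := by
  have hd1 : 1 ≤ d := by omega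
  have hred : ∀ T T', S.restr T' (S.coarseIndicator T) ∈ Qred T' :=
    S.restr_coarseIndicator_mem hone
  have hDG : ∀ T, S.InDG k (S.coarseIndicator T) := fun T T' => hsub T' (hred T T')
  exact ⟨hu_h.locallyConservative hd1 hΩ fun T => hp_h.2 _ (hDG T),
    hu_red.locallyConservative hd1 hΩ fun T => hp_red.2 _ ⟨hDG T, hred T⟩⟩
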